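/- **Lemma (generalized non-commutative Hölder inequality).** Let $L$ be a natural number and let $A_1,\dots,A_L$ be a composable sequence of (not necessarily square) complex matrices, $A_i\in M(m_i\times n_i,\mathbb C)$ with $m_i=n_{i+1}$ for $1\le i<L$, and let $B=A_L\cdots A_1$. Let $p_1,\dots,p_L,r>0$ be real numbers with $\sum_{i=1}^L \frac1{p_i}=\frac1r$ (so that $L\ge 1$). For a complex matrix $A$ write $|A|:=\sqrt{A^*A}$, a positive semidefinite square matrix, and let $|A|^p$ (for $p>0$) be its $p$-th power in the sense of the functional calculus: if $|A|=U\,\mathrm{diag}(\lambda_j)\,U^*$ with $U$ unitary, then $|A|^p=U\,\mathrm{diag}(\lambda_j^p)\,U^*$. A *compatible family of matrix norms* is a function $|||\cdot|||$ assigning to every complex matrix of any finite size a nonnegative real number such that (i) its restriction to $M(m\times n,\mathbb C)$ is a norm on that complex vector space for all $m,n\in\mathbb N$, and (ii) whenever $m'\ge m$ and $n'\ge n$, every $A\in M(m\times n,\mathbb C)$ satisfies $|||\iota(A)|||=|||A|||$, where $\iota(A)=\begin{bmatrix}A&0\\0&0\end{bmatrix}\in M(m'\times n',\mathbb C)$.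 It is *unitary invariant* if $|||UAV^T|||=|||A|||$ for all $A\in M(m\times n,\mathbb C)$ and all unitary $U\in U(m)$, $V\in U(n)$. 1. For every unitary invariant compatible family of matrix norms $|||\cdot|||$, $$\bigl|\bigl|\bigl|\,|B|^r\,\bigr|\bigr|\bigr|^{1/r}\;\le\;\prod_{i=1}^L \bigl|\bigl|\bigl|\,|A_i|^{p_i}\,\bigr|\bigr|\bigr|^{1/p_i}.$$ 2. For the Schatten (quasi-)norms $\|A\|_p^S:=\bigl(\sum_{i=1}^{\min\{m,n\}} s_i(A)^p\bigr)^{1/p}$, where $p>0$ and $s_1(A),\dots,s_{\min\{m,n\}}(A)\ge 0$ are the singular values of $A\in M(m\times n,\mathbb C)$ listed with multiplicity, $$\|B\|_r^S\;\le\;\prod_{i=1}^L\|A_i\|_{p_i}^S .$$ -/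

import Mathlib

open scoped Matrix MatrixOrder

noncomputable section

namespace MatrixHolder

/-- The product `A_L ⋯ A_1` of a composable sequence of rectangular complex matrices. The matrix
written `A_{i+1}` in mathematics is `A i`, and it has `d (i+1)` rows and `d i` columns. -/
def chainProd : (L : ℕ) → (d : Fin (L + 1) → ℕ) →
    ((i : Fin L) → Matrix (Fin (d i.succ)) (Fin (d i.castSucc)) ℂ) →
    Matrix (Fin (d (Fin.last L))) (Fin (d 0)) ℂ
  | 0, d, _ => (1 : Matrix (Fin (d 0)) (Fin (d 0)) ℂ)
  | L + 1, d, A => A (Fin.last L) * chainProd L (fun i => d i.castSucc) (fun i => A i.castSucc)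

/-- The polar part `|A| = √(A^* A)` of a rectangular complex matrix. -/
def polarPart {m n : ℕ} (A : Matrix (Fin m) (Fin n) ℂ) : Matrix (Fin n) (Fin n) ℂ :=
  CFC.sqrt (Aᴴ * A)

/-- The matrix `|A| ^ p` for a real exponent `p`, in the sense of the functional calculus. -/
def polarPow {m n : ℕ} (A : Matrix (Fin m) (Fin n) ℂ) (p : ℝ) : Matrix (Fin n) (Fin n) ℂ :=
  CFC.rpow (polarPart A) p

/-- The upper left block inclusion `A ↦ [A 0; 0 0]` of `m × n` matrices into `m' × n'` matrices
(used for `m ≤ m'` and `n ≤ n'`). -/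
def blockIncl {m n : ℕ} (m' n' : ℕ) (A : Matrix (Fin m) (Fin n) ℂ) :
    Matrix (Fin m') (Fin n') ℂ :=
  Matrix.of fun i j =>
    if h : (i : ℕ) < m ∧ (j : ℕ) < n then A ⟨i, h.1⟩ ⟨j, h.2⟩ else 0

/-- A real-valued function on all complex matrices of all finite sizes. -/
abbrev MatrixFunctionFamily : Type := (m n : ℕ) → Matrix (Fin m) (Fin n) ℂ → ℝ

/-- A compatible family of matrix norms: a norm on each space of `m × n` complex matrices,
unchanged by the upper left block inclusions. -/
structure IsCompatibleNormFamily (N : MatrixFunctionFamily) : Prop where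
  nonneg : ∀ (m n : ℕ) (A : Matrix (Fin m) (Fin n) ℂ), 0 ≤ N m n A
  eq_zero_iff : ∀ (m n : ℕ) (A : Matrix (Fin m) (Fin n) ℂ), N m n A = 0 ↔ A = 0
  smul : ∀ (m n : ℕ) (c : ℂ) (A : Matrix (Fin m) (Fin n) ℂ), N m n (c • A) = ‖c‖ * N m n A
  add_le : ∀ (m n : ℕ) (A B : Matrix (Fin m) (Fin n) ℂ), N m n (A + B) ≤ N m n A + N m n B
  blockIncl_eq : ∀ (m n m' n' : ℕ) (A : Matrix (Fin m) (Fin n) ℂ), m ≤ m' → n ≤ n' →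
    N m' n' (blockIncl m' n' A) = N m n A

/-- Unitary invariance: `N (U A Vᵀ) = N A` for all unitary `U`, `V`. -/
def IsUnitaryInvariant (N : MatrixFunctionFamily) : Prop :=
  ∀ (m n : ℕ) (A : Matrix (Fin m) (Fin n) ℂ) (U : Matrix (Fin m) (Fin m) ℂ)
    (V : Matrix (Fin n) (Fin n) ℂ), U ∈ Matrix.unitaryGroup (Fin m) ℂ →
    V ∈ Matrix.unitaryGroup (Fin n) ℂ → N m n (U * A * Vᵀ) = N m n A

/-- The Schatten `p`-(quasi-)norm `(∑_{i < min m n} s_i(A) ^ p) ^ (1 / p)`, where `s_i(A)` are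
the singular values of `A`, listed with multiplicity. -/
def schattenNorm {m n : ℕ} (p : ℝ) (A : Matrix (Fin m) (Fin n) ℂ) : ℝ :=
  (∑ i ∈ Finset.range (min m n), (Matrix.toEuclideanLin A).singularValues i ^ p) ^ (1 / p)

end MatrixHolder

end

namespace MatrixHolder

/-! Everything reduces to singular values. A unitary invariant norm of `|A|^p` depends only on the
numbers `s_i(A)^p`, and on real diagonal matrices it is a symmetric gauge: a norm on `ℝⁿ` invariant
under permutations and sign changes. The Schatten case is the ℓ¹ gauge, so one argument gives both
claims.

Horn's inequality (`prod_sv_chainProd_le`) says that the product of the top `k` singular values of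
`B` is at most the corresponding product over all factors. It holds because a matrix multiplies the
Gram determinant of `k` vectors by at most `s_1² ⋯ s_k²`, and these bounds compose along the chain.
Raised to the power `r`, it is a weak log-majorization, under which symmetric gauges are monotone
(`le_of_prod_le`: Abel summation and Hahn–Banach). Hölder's inequality for gauges
(`IsSymmetricGauge.holder`), a consequence of weighted AM–GM, with exponents `p_j / r` then finishes
the proof. -/

/-- The `i`-th singular value of a rectangular complex matrix, in decreasing order, extended by
zero. -/
noncomputable abbrev sv {m n : ℕ} (A : Matrix (Fin m) (Fin n) ℂ) (i : ℕ) : ℝ :=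
  (Matrix.toEuclideanLin A).singularValues i

/-! ### Gram determinants and Cauchy–Binet -/

/-- Listed increasingly, the `i`-th of `k` distinct naturals (counting from 0) is at least `i`, and
`D` decreases. -/
lemma prod_comp_le_prod_range {D : ℕ → ℝ} (hD : Antitone D) (h0 : ∀ i, 0 ≤ D i) {k : ℕ}
    (f : Fin k → ℕ) (hf : Function.Injective f) :
    ∏ i, D (f i) ≤ ∏ i ∈ Finset.range k, D i := by
  have hc : (Finset.univ.image f).card = k := by
    rw [Finset.card_image_of_injective _ hf, Finset.card_univ, Fintype.card_fin]
  have h1 : ∏ i, D (f i) = ∏ j ∈ Finset.univ.image f, D j :=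
    (Finset.prod_image fun _ _ _ _ h => hf h).symm
  have h2 : ∏ j ∈ Finset.univ.image f, D j
      = ∏ i : Fin k, D ((Finset.univ.image f).orderEmbOfFin hc i) := by
    conv_lhs => rw [← Finset.image_orderEmbOfFin_univ (Finset.univ.image f) hc]
    exact Finset.prod_image fun _ _ _ _ h => ((Finset.univ.image f).orderEmbOfFin hc).injective h
  rw [h1, h2, Finset.prod_range]
  refine Finset.prod_le_prod (fun _ _ => h0 _) fun i _ => hD ?_
  have hs := ((Finset.univ.image f).orderEmbOfFin hc).strictMono
  obtain ⟨i, hi⟩ := i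
  induction i with
  | zero => exact Nat.zero_le _
  | succ i ih =>
    exact Nat.succ_le_of_lt ((ih (by omega) (Finset.mem_univ _)).trans_lt
      (hs (show (⟨i, by omega⟩ : Fin k) < ⟨i + 1, hi⟩ from Nat.lt_succ_self i)))

/-- A symmetrised form of the Cauchy–Binet formula. -/
lemma factorial_mul_det_conjTranspose_mul_diagonal_mul {n k : ℕ} (D : Fin n → ℝ)
    (W : Matrix (Fin n) (Fin k) ℂ) :
    (k.factorial : ℂ) * (Wᴴ * Matrix.diagonal (fun i => (D i : ℂ)) * W).det
      = ((∑ f : Fin k → Fin n, (∏ i, D (f i)) * Complex.normSq (W.submatrix f id).det : ℝ) : ℂ) := by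
  have key : (Wᴴ * Matrix.diagonal (fun i => (D i : ℂ)) * W).det
      = ∑ f : Fin k → Fin n, (∏ i, star (W (f i) i) * (D (f i) : ℂ)) * (W.submatrix f id).det := by
    have hrow : (Wᴴ * Matrix.diagonal (fun i => (D i : ℂ)) * W)
        = fun i => ∑ j, (star (W j i) * (D j : ℂ)) • W j := by
      ext i l
      rw [Matrix.mul_apply]
      simp [Matrix.mul_diagonal, Finset.sum_apply]
    rw [hrow]
    change Matrix.detRowAlternating.toMultilinearMap _ = _
    rw [MultilinearMap.map_sum]
    refine Finset.sum_congr rfl fun f _ => ?_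
    exact MultilinearMap.map_smul_univ _ (fun i => star (W (f i) i) * (D (f i) : ℂ))
      (fun i => W (f i))
  -- Reindexing `f` by `σ` permutes the rows of the minor and produces a sign; summing over all `σ`
  -- rebuilds the conjugate minor and accounts for the factor `k!`.
  have hperm (σ : Equiv.Perm (Fin k)) : (Wᴴ * Matrix.diagonal (fun i => (D i : ℂ)) * W).det
      = ∑ f : Fin k → Fin n, (∏ i, (D (f i) : ℂ)) * ((Equiv.Perm.sign σ : ℤ) : ℂ) *
        (∏ i, star (W (f (σ i)) i)) * (W.submatrix f id).det := by
    rw [key, ← Equiv.sum_comp (σ.arrowCongr (Equiv.refl (Fin n))).symm]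
    refine Finset.sum_congr rfl fun f _ => ?_
    have h1 : ((σ.arrowCongr (Equiv.refl (Fin n))).symm f) = fun i => f (σ i) := rfl
    have h2 : (W.submatrix (fun i => f (σ i)) id).det
        = ((Equiv.Perm.sign σ : ℤ) : ℂ) * (W.submatrix f id).det :=
      Matrix.det_permute σ (W.submatrix f id)
    rw [h1, h2, Finset.prod_mul_distrib, Equiv.prod_comp σ fun i => (D (f i) : ℂ)]
    ring
  have hsum : (k.factorial : ℂ) * (Wᴴ * Matrix.diagonal (fun i => (D i : ℂ)) * W).det
      = ∑ _σ : Equiv.Perm (Fin k), (Wᴴ * Matrix.diagonal (fun i => (D i : ℂ)) * W).det := by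
    simp [Fintype.card_perm]
  rw [hsum, Finset.sum_congr rfl fun σ _ => hperm σ, Finset.sum_comm, Complex.ofReal_sum]
  refine Finset.sum_congr rfl fun f _ => ?_
  have hdet : star (W.submatrix f id).det
      = ∑ σ : Equiv.Perm (Fin k), ((Equiv.Perm.sign σ : ℤ) : ℂ) * ∏ i, star (W (f (σ i)) i) := by
    rw [Matrix.det_apply', star_sum]
    refine Finset.sum_congr rfl fun σ _ => ?_
    simp [star_mul', star_prod]
  rw [Complex.ofReal_mul, ← Complex.mul_conj, Complex.ofReal_prod]
  change _ = _ * (_ * star _)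
  rw [hdet, Finset.mul_sum, Finset.mul_sum]
  exact Finset.sum_congr rfl fun σ _ => by ring

/-- The Cauchy–Binet sums for `D` and for the constant 1 are compared term by term; a non-injective
`f` repeats a row, so its minor vanishes. -/
lemma det_conjTranspose_mul_diagonal_mul_le {n k : ℕ} {D : ℕ → ℝ} (hD : Antitone D)
    (h0 : ∀ i, 0 ≤ D i) (W : Matrix (Fin n) (Fin k) ℂ) :
    (Wᴴ * Matrix.diagonal (fun i : Fin n => (D i : ℂ)) * W).det.re
      ≤ (∏ i ∈ Finset.range k, D i) * (Wᴴ * W).det.re := by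
  have h1 := congrArg Complex.re
    (factorial_mul_det_conjTranspose_mul_diagonal_mul (fun i : Fin n => D i) W)
  have h2 := congrArg Complex.re
    (factorial_mul_det_conjTranspose_mul_diagonal_mul (fun _ : Fin n => 1) W)
  rw [← Complex.ofReal_natCast, Complex.re_ofReal_mul, Complex.ofReal_re] at h1 h2
  simp only [Complex.ofReal_one, Matrix.diagonal_one, Matrix.mul_one, Finset.prod_const_one,
    one_mul] at h2
  have hk : (0 : ℝ) < k.factorial := by exact_mod_cast k.factorial_pos
  refine le_of_mul_le_mul_left ?_ hk
  rw [h1, mul_left_comm, h2, Finset.mul_sum]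
  refine Finset.sum_le_sum fun f _ => ?_
  by_cases hf : Function.Injective f
  · exact mul_le_mul_of_nonneg_right
      (prod_comp_le_prod_range hD h0 (fun i => (f i : ℕ)) (Fin.val_injective.comp hf))
      (Complex.normSq_nonneg _)
  · have : (W.submatrix f id).det = 0 := by
      simp only [Function.Injective, not_forall] at hf
      obtain ⟨i, j, hij, hne⟩ := hf
      exact Matrix.det_zero_of_row_eq hne (by ext l; simp [hij])
    simp [this]

/-! ### Spectral form of `A^* A` and of `|A|^p` -/

/-- Simultaneous diagonalisation of all functions of `A^* A`, with sorted singular values. -/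
lemma exists_unitary_cfc_conjTranspose_mul_self {m n : ℕ} (A : Matrix (Fin m) (Fin n) ℂ) :
    ∃ U ∈ Matrix.unitaryGroup (Fin n) ℂ, ∀ f : ℝ → ℝ,
      cfc f (Aᴴ * A) = U * Matrix.diagonal (fun i : Fin n => (f (sv A i ^ 2) : ℂ)) * Uᴴ := by
  have hA : (Aᴴ * A).IsHermitian := Matrix.isHermitian_conjTranspose_mul_self A
  -- Eigenvalues on `Fin n` are indexed through an arbitrary equivalence, so they match the sorted
  -- singular values only up to a permutation, later absorbed into the columns of `U`.
  obtain ⟨σ, hσ⟩ : ∃ σ : Equiv.Perm (Fin n), ∀ i, hA.eigenvalues i = sv A (σ i) ^ 2 := by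
    let e : Fin (Fintype.card (Fin n)) ≃ Fin n :=
      Fintype.equivOfCardEq (Fintype.card_fin _)
    refine ⟨e.symm.trans (finCongr (Fintype.card_fin n)), fun i => ?_⟩
    have hT : Matrix.toEuclideanLin (Aᴴ * A)
        = LinearMap.adjoint (Matrix.toEuclideanLin A) ∘ₗ Matrix.toEuclideanLin A := by
      rw [← Matrix.toEuclideanLin_conjTranspose_eq_adjoint]
      ext x i
      simp [Matrix.toLpLin_apply, Matrix.mulVec_mulVec]
    have h := (Matrix.toEuclideanLin A).sq_singularValues_fin
      (finrank_euclideanSpace (𝕜 := ℂ) (ι := Fin n)) (e.symm i)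
    simp only [Equiv.trans_apply, finCongr_apply, Fin.val_cast]
    rw [h, Matrix.IsHermitian.eigenvalues, Matrix.IsHermitian.eigenvalues₀]
    congr!
  let E : Matrix (Fin n) (Fin n) ℂ := hA.eigenvectorUnitary
  have hE : E ∈ Matrix.unitaryGroup (Fin n) ℂ := hA.eigenvectorUnitary.2
  refine ⟨E.submatrix id σ.symm, ?_, fun f => ?_⟩
  · rw [Matrix.mem_unitaryGroup_iff, Matrix.star_eq_conjTranspose, Matrix.conjTranspose_submatrix,
      Matrix.submatrix_mul_equiv, ← Matrix.star_eq_conjTranspose,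
      Matrix.mem_unitaryGroup_iff.mp hE, Matrix.submatrix_id_id]
  · have hd : Matrix.diagonal (fun i : Fin n => (f (sv A i ^ 2) : ℂ))
        = (Matrix.diagonal (fun i => (f (hA.eigenvalues i) : ℂ))).submatrix σ.symm σ.symm := by
      rw [Matrix.submatrix_diagonal_equiv]
      congr 1
      ext i
      simp [hσ]
    rw [hd, Matrix.conjTranspose_submatrix, Matrix.submatrix_mul_equiv,
      Matrix.submatrix_mul_equiv, Matrix.submatrix_id_id, hA.cfc_eq, Matrix.IsHermitian.cfc,
      Unitary.conjStarAlgAut_apply]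
    rfl

lemma exists_unitary_conjTranspose_mul_self {m n : ℕ} (A : Matrix (Fin m) (Fin n) ℂ) :
    ∃ U ∈ Matrix.unitaryGroup (Fin n) ℂ,
      Aᴴ * A = U * Matrix.diagonal (fun i : Fin n => ((sv A i ^ 2 : ℝ) : ℂ)) * Uᴴ := by
  obtain ⟨U, hU, h⟩ := exists_unitary_cfc_conjTranspose_mul_self A
  refine ⟨U, hU, ?_⟩
  rw [← h fun x => x]
  exact (cfc_id' ℝ (Aᴴ * A) (Matrix.isHermitian_conjTranspose_mul_self A)).symm

open scoped ComplexOrder in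
lemma exists_unitary_polarPow {m n : ℕ} (A : Matrix (Fin m) (Fin n) ℂ) {p : ℝ} (hp : 0 < p) :
    ∃ U ∈ Matrix.unitaryGroup (Fin n) ℂ,
      polarPow A p = U * Matrix.diagonal (fun i : Fin n => ((sv A i ^ p : ℝ) : ℂ)) * Uᴴ := by
  obtain ⟨U, hU, h⟩ := exists_unitary_cfc_conjTranspose_mul_self A
  refine ⟨U, hU, ?_⟩
  have hA : 0 ≤ Aᴴ * A := (Matrix.posSemidef_conjTranspose_mul_self A).nonneg
  have h1 : polarPow A p = cfc (fun x : ℝ => x ^ (p / 2)) (Aᴴ * A) := by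
    rw [← CFC.rpow_eq_cfc_real hA, polarPow, polarPart, CFC.sqrt_eq_rpow]
    change ((Aᴴ * A) ^ (1 / 2 : ℝ)) ^ p = _
    rw [CFC.rpow_rpow_of_exponent_nonneg _ _ _ (by norm_num) hp.le hA]
    congr 1
    ring
  rw [h1, h]
  congr 3
  ext i
  have := (Matrix.toEuclideanLin A).singularValues_nonneg i
  rw [← Real.rpow_natCast, ← Real.rpow_mul this]
  congr 2
  push_cast
  ring

lemma sv_nonneg {m n : ℕ} (A : Matrix (Fin m) (Fin n) ℂ) (i : ℕ) : 0 ≤ sv A i :=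
  (Matrix.toEuclideanLin A).singularValues_nonneg i

lemma sv_antitone {m n : ℕ} (A : Matrix (Fin m) (Fin n) ℂ) : Antitone (sv A) :=
  (Matrix.toEuclideanLin A).singularValues_antitone

lemma sv_eq_zero_of_le {m n : ℕ} (A : Matrix (Fin m) (Fin n) ℂ) {i : ℕ} (hi : min m n ≤ i) :
    sv A i = 0 := by
  rw [sv, LinearMap.singularValues_eq_zero_iff_le_finrank_range]
  refine le_trans (le_min ?_ ?_) hi
  · simpa using Submodule.finrank_le (LinearMap.range (Matrix.toEuclideanLin A))
  · simpa using LinearMap.finrank_range_le (Matrix.toEuclideanLin A)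

/-! ### Horn's inequality -/

lemma det_conjTranspose_mul_self_mul_le {m n k : ℕ} (A : Matrix (Fin m) (Fin n) ℂ)
    (V : Matrix (Fin n) (Fin k) ℂ) :
    ((A * V)ᴴ * (A * V)).det.re ≤ (∏ i ∈ Finset.range k, sv A i ^ 2) * (Vᴴ * V).det.re := by
  obtain ⟨U, hU, h⟩ := exists_unitary_conjTranspose_mul_self A
  have := det_conjTranspose_mul_diagonal_mul_le (D := fun i => sv A i ^ 2)
    (fun i j hij => pow_le_pow_left₀ (sv_nonneg A j) (sv_antitone A hij) 2)
    (fun i => sq_nonneg _) (Uᴴ * V)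
  have h1 : (A * V)ᴴ * (A * V)
      = (Uᴴ * V)ᴴ * Matrix.diagonal (fun i : Fin n => ((sv A i ^ 2 : ℝ) : ℂ)) * (Uᴴ * V) := by
    rw [Matrix.conjTranspose_mul, Matrix.mul_assoc, ← Matrix.mul_assoc Aᴴ, h]
    simp only [Matrix.conjTranspose_mul, Matrix.conjTranspose_conjTranspose, Matrix.mul_assoc]
  have h2 : (Uᴴ * V)ᴴ * (Uᴴ * V) = Vᴴ * V := by
    rw [Matrix.conjTranspose_mul, Matrix.conjTranspose_conjTranspose, Matrix.mul_assoc,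
      ← Matrix.mul_assoc U, ← Matrix.star_eq_conjTranspose U, Matrix.mem_unitaryGroup_iff.mp hU,
      Matrix.one_mul]
  rw [h1]
  rwa [h2] at this

/-- Allowing arbitrary `V` makes the induction run: the partial product applied to `V` is the new
test matrix for the last factor. -/
lemma det_chainProd_le {k : ℕ} (L : ℕ) (d : Fin (L + 1) → ℕ)
    (A : (i : Fin L) → Matrix (Fin (d i.succ)) (Fin (d i.castSucc)) ℂ)
    (V : Matrix (Fin (d 0)) (Fin k) ℂ) :
    ((chainProd L d A * V)ᴴ * (chainProd L d A * V)).det.re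
      ≤ (∏ j, ∏ i ∈ Finset.range k, sv (A j) i ^ 2) * (Vᴴ * V).det.re := by
  induction L with
  | zero => simp [chainProd]
  | succ L ih =>
    let V' : Matrix (Fin (d (Fin.castSucc 0))) (Fin k) ℂ := V
    have h1 := ih (fun i => d i.castSucc) (fun i => A i.castSucc) V'
    have h2 := det_conjTranspose_mul_self_mul_le (A (Fin.last L))
      (chainProd L (fun i => d i.castSucc) (fun i => A i.castSucc) * V')
    rw [Fin.prod_univ_castSucc, mul_comm (∏ j : Fin L, _), mul_assoc]
    rw [← Matrix.mul_assoc (A (Fin.last L)) _ V'] at h2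
    exact h2.trans (mul_le_mul_of_nonneg_left h1
      (Finset.prod_nonneg fun _ _ => sq_nonneg _))

/-- **Horn's inequality** for the singular values of a product of matrices. -/
lemma prod_sv_chainProd_le (L : ℕ) (d : Fin (L + 1) → ℕ)
    (A : (i : Fin L) → Matrix (Fin (d i.succ)) (Fin (d i.castSucc)) ℂ) (k : ℕ) :
    ∏ i ∈ Finset.range k, sv (chainProd L d A) i
      ≤ ∏ i ∈ Finset.range k, ∏ j, sv (A j) i := by
  have hR : 0 ≤ ∏ i ∈ Finset.range k, ∏ j, sv (A j) i :=
    Finset.prod_nonneg fun _ _ => Finset.prod_nonneg fun _ _ => sv_nonneg _ _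
  by_cases hk : k ≤ d 0
  · obtain ⟨U, hU, h⟩ := exists_unitary_conjTranspose_mul_self (chainProd L d A)
    have hU' : Uᴴ * U = 1 := Matrix.mem_unitaryGroup_iff'.mp hU
    -- The test vectors are the top `k` right singular vectors of the product, whose images are
    -- orthogonal with norms `sv i`.
    have hle := det_chainProd_le L d A (U.submatrix id (Fin.castLE hk))
    have e1 : ((U.submatrix id (Fin.castLE hk))ᴴ * U.submatrix id (Fin.castLE hk)) = 1 := by
      rw [Matrix.conjTranspose_submatrix, ← Matrix.submatrix_mul _ _ _ _ _ Function.bijective_id,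
        hU', Matrix.submatrix_one _ (Fin.castLE_injective hk)]
    have e2 : ((chainProd L d A * U.submatrix id (Fin.castLE hk))ᴴ *
        (chainProd L d A * U.submatrix id (Fin.castLE hk)))
        = Matrix.diagonal (fun i : Fin k => ((sv (chainProd L d A) i ^ 2 : ℝ) : ℂ)) := by
      have : chainProd L d A * U.submatrix id (Fin.castLE hk)
          = (chainProd L d A * U).submatrix id (Fin.castLE hk) := rfl
      rw [this, Matrix.conjTranspose_submatrix,
        ← Matrix.submatrix_mul _ _ _ _ _ Function.bijective_id, Matrix.conjTranspose_mul,
        Matrix.mul_assoc, ← Matrix.mul_assoc (chainProd L d A)ᴴ, h, Matrix.mul_assoc,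
        hU', Matrix.mul_one, ← Matrix.mul_assoc, hU', Matrix.one_mul,
        Matrix.submatrix_diagonal _ _ (Fin.castLE_injective hk)]
      rfl
    rw [e1, e2, Matrix.det_diagonal, Matrix.det_one, Complex.one_re, mul_one,
      ← Complex.ofReal_prod, Complex.ofReal_re, Finset.prod_comm, ← Finset.prod_range
      (fun i => sv (chainProd L d A) i ^ 2)] at hle
    simp only [Finset.prod_pow] at hle
    exact le_of_sq_le_sq hle hR
  -- For `k > d 0` the left side contains the vanishing factor of index `d 0`.
  · rw [Finset.prod_eq_zero (Finset.mem_range.mpr (not_le.mp hk))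
      (sv_eq_zero_of_le _ (min_le_right _ _))]
    exact hR

/-! ### From log-majorization to weighted sums -/

/-- Abel summation, in the stronger form with lower bound `f n` times the partial sum of `g`, which
passes through induction. -/
lemma sum_mul_nonneg_of_antitone {f g : ℕ → ℝ} (hf : Antitone f) (h0 : ∀ i, 0 ≤ f i)
    (hg : ∀ k, 0 ≤ ∑ i ∈ Finset.range k, g i) (n : ℕ) :
    0 ≤ ∑ i ∈ Finset.range n, f i * g i := by
  suffices h : f n * ∑ i ∈ Finset.range n, g i ≤ ∑ i ∈ Finset.range n, f i * g i from
    (mul_nonneg (h0 n) (hg n)).trans h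
  induction n with
  | zero => simp
  | succ n ih =>
    calc f (n + 1) * ∑ i ∈ Finset.range (n + 1), g i
        ≤ f n * ∑ i ∈ Finset.range (n + 1), g i :=
          mul_le_mul_of_nonneg_right (hf n.le_succ) (hg _)
      _ ≤ ∑ i ∈ Finset.range (n + 1), f i * g i := by
          rw [Finset.sum_range_succ, Finset.sum_range_succ, mul_add]
          linarith

/-- Weak log-majorization implies weak majorization, in dual form. -/
lemma sum_mul_le_sum_mul_of_prod_le {w x y : ℕ → ℝ} (hw : Antitone w) (hw0 : ∀ i, 0 ≤ w i)
    (hx : Antitone x) (hx0 : ∀ i, 0 ≤ x i) (hy0 : ∀ i, 0 ≤ y i)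
    (h : ∀ k, ∏ i ∈ Finset.range k, x i ≤ ∏ i ∈ Finset.range k, y i) (n : ℕ) :
    ∑ i ∈ Finset.range n, w i * x i ≤ ∑ i ∈ Finset.range n, w i * y i := by
  have hxpos (k : ℕ) (hk : x k ≠ 0) (i : ℕ) (hi : i ≤ k) : 0 < x i :=
    ((hx0 k).lt_of_ne' hk).trans_le (hx hi)
  have hypos (k : ℕ) (hk : x k ≠ 0) (i : ℕ) (hi : i ≤ k) : 0 < y i := by
    have h1 : 0 < ∏ i ∈ Finset.range (k + 1), y i :=
      (Finset.prod_pos fun i hi => hxpos k hk i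
        (Nat.lt_succ_iff.mp (Finset.mem_range.mp hi))).trans_le (h (k + 1))
    exact (hy0 i).lt_of_ne'
      (Finset.prod_ne_zero_iff.mp h1.ne' i (Finset.mem_range.mpr (Nat.lt_succ_of_le hi)))
  -- The log-ratio is cut off where `x` vanishes; as `x` decreases, this affects only a tail, so
  -- partial sums stay nonnegative.
  let g : ℕ → ℝ := fun i => if x i = 0 then 0 else Real.log (y i) - Real.log (x i)
  have hg (k : ℕ) : 0 ≤ ∑ i ∈ Finset.range k, g i := by
    induction k with
    | zero => simp
    | succ k ih =>
      by_cases hk : x k = 0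
      · simpa [Finset.sum_range_succ, g, hk] using ih
      · have hm (i : ℕ) (hi : i ∈ Finset.range (k + 1)) : i ≤ k :=
          Nat.lt_succ_iff.mp (Finset.mem_range.mp hi)
        have h1 : ∑ i ∈ Finset.range (k + 1), g i
            = ∑ i ∈ Finset.range (k + 1), (Real.log (y i) - Real.log (x i)) :=
          Finset.sum_congr rfl fun i hi => if_neg (hxpos k hk i (hm i hi)).ne'
        rw [h1, Finset.sum_sub_distrib,
          ← Real.log_prod fun i hi => (hypos k hk i (hm i hi)).ne',
          ← Real.log_prod fun i hi => (hxpos k hk i (hm i hi)).ne', sub_nonneg]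
        exact Real.log_le_log (Finset.prod_pos fun i hi => hxpos k hk i (hm i hi)) (h _)
  have hf : Antitone fun i => w i * x i := fun i j hij =>
    mul_le_mul (hw hij) (hx hij) (hx0 j) (hw0 i)
  have key := sum_mul_nonneg_of_antitone hf (fun i => mul_nonneg (hw0 i) (hx0 i)) hg n
  rw [← sub_nonneg, ← Finset.sum_sub_distrib]
  -- Termwise, `log t ≤ t - 1` at `t = y i / x i` gives `x i * g i ≤ y i - x i`.
  refine key.trans (Finset.sum_le_sum fun i _ => ?_)
  rw [mul_assoc, ← mul_sub]
  refine mul_le_mul_of_nonneg_left ?_ (hw0 i)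
  by_cases hi : x i = 0
  · simp [hi, hy0 i]
  · have hxi := hxpos i hi i le_rfl
    have hyi := hypos i hi i le_rfl
    have h1 := Real.log_le_sub_one_of_pos (div_pos hyi hxi)
    rw [Real.log_div hyi.ne' hxi.ne'] at h1
    calc x i * g i = x i * (Real.log (y i) - Real.log (x i)) := by simp [g, hi]
      _ ≤ x i * (y i / x i - 1) := mul_le_mul_of_nonneg_left h1 hxi.le
      _ = y i - x i := by field_simp

/-! ### Symmetric gauges -/

lemma exists_units_int_mul_eq_abs (w : ℝ) :
    ∃ ε : ℤˣ, w * ((ε : ℤ) : ℝ) = |w| := by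
  rcases le_total 0 w with h | h
  · exact ⟨1, by simp [abs_of_nonneg h]⟩
  · exact ⟨-1, by simp [abs_of_nonpos h]⟩

/-- A norm on `ℝⁿ` invariant under permutations and sign changes of the coordinates. -/
structure IsSymmetricGauge {n : ℕ} (Φ : (Fin n → ℝ) → ℝ) : Prop where
  nonneg : ∀ x, 0 ≤ Φ x
  eq_zero : ∀ x, Φ x = 0 → x = 0
  smul : ∀ (c : ℝ) (x), Φ (c • x) = |c| * Φ x
  add_le : ∀ x y, Φ (x + y) ≤ Φ x + Φ y
  perm : ∀ (σ : Equiv.Perm (Fin n)) (x), Φ (fun i => x (σ i)) = Φ x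
  sign : ∀ (ε : Fin n → ℤˣ) (x), Φ (fun i => ((ε i : ℤ) : ℝ) * x i) = Φ x

namespace IsSymmetricGauge

variable {n : ℕ} {Φ : (Fin n → ℝ) → ℝ}

lemma map_zero (hΦ : IsSymmetricGauge Φ) : Φ 0 = 0 := by
  simpa using hΦ.smul 0 0

lemma convex_sublevel (hΦ : IsSymmetricGauge Φ) (c : ℝ) : Convex ℝ {z | Φ z ≤ c} := by
  intro u hu v hv a b ha hb hab
  have h := hΦ.add_le (a • u) (b • v)
  rw [hΦ.smul, hΦ.smul, abs_of_nonneg ha, abs_of_nonneg hb] at h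
  calc Φ (a • u + b • v) ≤ a * Φ u + b * Φ v := h
    _ ≤ a * c + b * c :=
      add_le_add (mul_le_mul_of_nonneg_left hu ha) (mul_le_mul_of_nonneg_left hv hb)
    _ = c := by rw [← add_mul, hab, one_mul]

/-- If `x` is not separated by any functional from the signed permutations of `y`, then the gauge
of `x` is at most that of `y`. -/
lemma le_of_forall_exists_signed_perm (hΦ : IsSymmetricGauge Φ) {x y : Fin n → ℝ}
    (h : ∀ w : Fin n → ℝ, ∃ (ε : Fin n → ℤˣ) (σ : Equiv.Perm (Fin n)),
      ∑ i, w i * x i ≤ ∑ i, w i * (((ε i : ℤ) : ℝ) * y (σ i))) : Φ x ≤ Φ y := by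
  let S : Set (Fin n → ℝ) := Set.range fun q : (Fin n → ℤˣ) × Equiv.Perm (Fin n) =>
    fun i => ((q.1 i : ℤ) : ℝ) * y (q.2 i)
  have hS : S.Finite := Set.finite_range _
  suffices hx : x ∈ convexHull ℝ S by
    refine convexHull_min ?_ (hΦ.convex_sublevel (Φ y)) hx
    rintro _ ⟨q, rfl⟩
    exact ((hΦ.sign q.1 _).trans (hΦ.perm q.2 y)).le
  -- A point outside the hull is strictly separated from it by a functional; its coefficients serve
  -- as the `w` that contradicts `h`.
  by_contra hx
  obtain ⟨f, u, hfS, hfx⟩ :=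
    geometric_hahn_banach_closed_point (convex_convexHull ℝ S) (hS.isClosed_convexHull ℝ) hx
  have hf (z : Fin n → ℝ) : f z = ∑ i, f (Pi.single i 1) * z i := by
    have := LinearMap.pi_apply_eq_sum_univ f.toLinearMap z
    simp only [smul_eq_mul, ContinuousLinearMap.coe_coe] at this
    rw [this]
    refine Finset.sum_congr rfl fun i _ => ?_
    rw [mul_comm]
    congr 2
    ext j
    simp [Pi.single_apply, eq_comm]
  obtain ⟨ε, σ, hle⟩ := h fun i => f (Pi.single i 1)
  have := hfS _ (subset_convexHull ℝ S ⟨(ε, σ), rfl⟩)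
  rw [hf] at this hfx
  exact absurd (hfx.trans_le hle) (not_lt.mpr this.le)

lemma mono (hΦ : IsSymmetricGauge Φ) {x y : Fin n → ℝ} (hx : ∀ i, 0 ≤ x i)
    (hxy : ∀ i, x i ≤ y i) : Φ x ≤ Φ y := by
  refine hΦ.le_of_forall_exists_signed_perm fun w => ?_
  choose ε hε using exists_units_int_mul_eq_abs
  refine ⟨fun i => ε (w i), Equiv.refl _, Finset.sum_le_sum fun i _ => ?_⟩
  rw [← mul_assoc, hε]
  exact mul_le_mul (le_abs_self _) (hxy i) (hx i) (abs_nonneg _)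

/-- Symmetric gauges are monotone with respect to weak log-majorization. -/
lemma le_of_prod_le (hΦ : IsSymmetricGauge Φ) {x y : ℕ → ℝ} (hx : Antitone x)
    (hx0 : ∀ i, 0 ≤ x i) (hy0 : ∀ i, 0 ≤ y i)
    (h : ∀ k, ∏ i ∈ Finset.range k, x i ≤ ∏ i ∈ Finset.range k, y i) :
    Φ (fun i => x i) ≤ Φ (fun i => y i) := by
  refine hΦ.le_of_forall_exists_signed_perm fun w => ?_
  choose ε hε using exists_units_int_mul_eq_abs
  -- Sorting `|w|` decreasingly, like `x`, can only increase the pairing with `x` (rearrangement);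
  -- the sort is undone on the `y` side by `τ.symm`.
  let τ := Tuple.sort fun i => -|w i|
  have hτ : Antitone fun i => |w (τ i)| := fun i j hij =>
    neg_le_neg_iff.mp (Tuple.monotone_sort (fun i => -|w i|) hij)
  refine ⟨fun i => ε (w i), τ.symm, ?_⟩
  let v : ℕ → ℝ := fun i => if hi : i < n then |w (τ ⟨i, hi⟩)| else 0
  have hv0 (i : ℕ) : 0 ≤ v i := by
    simp only [v]
    split_ifs
    exacts [abs_nonneg _, le_rfl]
  have hv : Antitone v := by
    intro i j hij
    by_cases hj : j < n
    · simpa [v, hj, hij.trans_lt hj] using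
        hτ (show (⟨i, hij.trans_lt hj⟩ : Fin n) ≤ ⟨j, hj⟩ from hij)
    · simpa [v, hj] using hv0 i
  have h1 : ∑ i, |w i| * x i ≤ ∑ i, |w (τ i)| * x i := by
    have hm : Monovary (fun i => |w (τ i)|) (fun i : Fin n => x i) :=
      hτ.monovary fun i j hij => hx hij
    simpa using hm.sum_comp_perm_mul_le_sum_mul (σ := τ.symm)
  have h2 : ∑ i, |w (τ i)| * x i ≤ ∑ i, |w (τ i)| * y i := by
    have := sum_mul_le_sum_mul_of_prod_le hv hv0 hx hx0 hy0 h n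
    simpa [Finset.sum_range, v] using this
  calc ∑ i, w i * x i ≤ ∑ i, |w i| * x i :=
        Finset.sum_le_sum fun i _ => mul_le_mul_of_nonneg_right (le_abs_self _) (hx0 i)
    _ ≤ ∑ i, |w (τ i)| * y i := h1.trans h2
    _ = ∑ i, |w i| * y (τ.symm i) := by
        rw [← Equiv.sum_comp τ fun i => |w i| * y (τ.symm i)]
        simp
    _ = ∑ i, w i * (((ε (w i) : ℤ) : ℝ) * y (τ.symm i)) :=
        Finset.sum_congr rfl fun i _ => by rw [← mul_assoc, hε]

/-- **Hölder's inequality** for symmetric gauges. -/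
lemma holder (hΦ : IsSymmetricGauge Φ) {ι : Type*} [Fintype ι] (y : ι → Fin n → ℝ)
    (hy : ∀ j i, 0 ≤ y j i) (q : ι → ℝ) (hq : ∀ j, 0 < q j) (hsum : ∑ j, 1 / q j = 1) :
    Φ (fun i => ∏ j, y j i) ≤ ∏ j, Φ (fun i => y j i ^ q j) ^ (1 / q j) := by
  have hnn (j : ι) : 0 ≤ Φ (fun i => y j i ^ q j) := hΦ.nonneg _
  by_cases h0 : ∃ j, Φ (fun i => y j i ^ q j) = 0
  · obtain ⟨j, hj⟩ := h0
    have hz : (fun i => ∏ j, y j i) = 0 := by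
      funext i
      have := congrFun (hΦ.eq_zero _ hj) i
      exact Finset.prod_eq_zero (Finset.mem_univ j)
        ((Real.rpow_eq_zero (hy j i) (hq j).ne').mp this)
    rw [hz, hΦ.map_zero]
    exact Finset.prod_nonneg fun j _ => Real.rpow_nonneg (hnn j) _
  push Not at h0
  have hpos (j : ι) : 0 < Φ (fun i => y j i ^ q j) := (hnn j).lt_of_ne' (h0 j)
  set c : ι → ℝ := fun j => Φ (fun i => y j i ^ q j) with hc
  set C : ℝ := ∏ j, c j ^ (1 / q j) with hC
  have hCpos : 0 < C := Finset.prod_pos fun j _ => Real.rpow_pos_of_pos (hpos j) _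
  -- Weighted AM–GM applied to the normalised terms `y j i ^ q j / c j`, each of gauge 1; the
  -- division requires every `c j` to be nonzero.
  have hle (i : Fin n) :
      ∏ j, y j i ≤ (C • ∑ j, (1 / q j / c j) • fun i => y j i ^ q j) i := by
    have h1 := Real.geom_mean_le_arith_mean_weighted Finset.univ (fun j => 1 / q j)
      (fun j => y j i ^ q j / c j) (fun j _ => (one_div_pos.mpr (hq j)).le) hsum
      (fun j _ => div_nonneg (Real.rpow_nonneg (hy j i) _) (hnn j))
    have h2 : ∏ j, (y j i ^ q j / c j) ^ (1 / q j) = (∏ j, y j i) / C := by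
      rw [hC, ← Finset.prod_div_distrib]
      refine Finset.prod_congr rfl fun j _ => ?_
      rw [Real.div_rpow (Real.rpow_nonneg (hy j i) _) (hnn j), ← Real.rpow_mul (hy j i),
        mul_one_div_cancel (hq j).ne', Real.rpow_one]
    rw [h2, div_le_iff₀ hCpos, mul_comm] at h1
    refine h1.trans_eq ?_
    simp only [Pi.smul_apply, Finset.sum_apply, smul_eq_mul]
    congr 1
    exact Finset.sum_congr rfl fun j _ => by ring
  have hsub (s : Finset ι) (z : ι → Fin n → ℝ) : Φ (∑ j ∈ s, z j) ≤ ∑ j ∈ s, Φ (z j) :=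
    Finset.le_sum_of_subadditive Φ hΦ.map_zero.le hΦ.add_le s z
  calc Φ (fun i => ∏ j, y j i)
      ≤ Φ (C • ∑ j, (1 / q j / c j) • fun i => y j i ^ q j) :=
        hΦ.mono (fun i => Finset.prod_nonneg fun j _ => hy j i) hle
    _ = C * Φ (∑ j, (1 / q j / c j) • fun i => y j i ^ q j) := by
        rw [hΦ.smul, abs_of_pos hCpos]
    _ ≤ C * ∑ j, Φ ((1 / q j / c j) • fun i => y j i ^ q j) :=
        mul_le_mul_of_nonneg_left (hsub _ _) hCpos.le
    _ = C * ∑ j, 1 / q j := by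
        congr 1
        refine Finset.sum_congr rfl fun j _ => ?_
        rw [hΦ.smul, abs_of_pos (div_pos (one_div_pos.mpr (hq j)) (hpos j))]
        exact div_mul_cancel₀ _ (hpos j).ne'
    _ = C := by rw [hsum, mul_one]

end IsSymmetricGauge

/-! ### The two gauges and their values on singular values -/

lemma isSymmetricGauge_sum_abs (n : ℕ) :
    IsSymmetricGauge fun x : Fin n → ℝ => ∑ i, |x i| where
  nonneg x := Finset.sum_nonneg fun _ _ => abs_nonneg _
  eq_zero x h := by
    funext i
    exact abs_eq_zero.mp
      ((Finset.sum_eq_zero_iff_of_nonneg fun _ _ => abs_nonneg _).mp h i (Finset.mem_univ i))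
  smul c x := by simp [abs_mul, Finset.mul_sum]
  add_le x y := by
    rw [← Finset.sum_add_distrib]
    exact Finset.sum_le_sum fun i _ => abs_add_le _ _
  perm σ x := Equiv.sum_comp σ fun i => |x i|
  sign ε x := by
    refine Finset.sum_congr rfl fun i _ => ?_
    rcases Int.units_eq_one_or (ε i) with h | h <;> simp [h]

/-- Coordinate permutations are two-sided products with permutation matrices, and sign changes are
left products with diagonal unitaries. -/
lemma isSymmetricGauge_diagonal {N : MatrixFunctionFamily} (hN : IsCompatibleNormFamily N)
    (hU : IsUnitaryInvariant N) (n : ℕ) :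
    IsSymmetricGauge fun x : Fin n → ℝ => N n n (Matrix.diagonal fun i => (x i : ℂ)) where
  nonneg x := hN.nonneg _ _ _
  eq_zero x h := by
    funext i
    have := congrFun (congrFun ((hN.eq_zero_iff _ _ _).mp h) i) i
    simpa using this
  smul c x := by
    have := hN.smul n n c (Matrix.diagonal fun i => (x i : ℂ))
    rw [Complex.norm_real, Real.norm_eq_abs] at this
    rw [← this]
    congr 1
    ext i j
    by_cases h : i = j <;> simp [h]
  add_le x y := by
    refine le_of_eq_of_le ?_ (hN.add_le n n _ _)
    rw [Matrix.diagonal_add]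
    simp
  perm σ x := by
    have hP : (1 : Matrix (Fin n) (Fin n) ℂ).submatrix σ id ∈ Matrix.unitaryGroup (Fin n) ℂ := by
      rw [Matrix.mem_unitaryGroup_iff, Matrix.star_eq_conjTranspose, Matrix.conjTranspose_submatrix,
        ← Matrix.submatrix_mul _ _ _ _ _ Function.bijective_id]
      simp
    rw [← hU n n (Matrix.diagonal fun i => (x i : ℂ)) _ _ hP hP]
    congr 1
    rw [Matrix.transpose_submatrix, Matrix.transpose_one,
      ← Matrix.submatrix_id_id (Matrix.diagonal fun i => (x i : ℂ)),
      ← Matrix.submatrix_mul _ _ _ _ _ Function.bijective_id,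
      ← Matrix.submatrix_mul _ _ _ _ _ Function.bijective_id,
      Matrix.one_mul, Matrix.mul_one, Matrix.submatrix_diagonal_equiv]
    rfl
  sign ε x := by
    have hD : Matrix.diagonal (fun i => ((ε i : ℤ) : ℂ)) ∈ Matrix.unitaryGroup (Fin n) ℂ := by
      rw [Matrix.mem_unitaryGroup_iff, Matrix.star_eq_conjTranspose, Matrix.diagonal_conjTranspose,
        Matrix.diagonal_mul_diagonal, ← Matrix.diagonal_one]
      congr 1
      funext i
      rcases Int.units_eq_one_or (ε i) with h | h <;> simp [h]
    rw [← hU n n (Matrix.diagonal fun i => (x i : ℂ)) _ 1 hD (one_mem _)]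
    simp

/-- Padding to a common size `l` lets one gauge serve all factors; `p > 0` makes the padded entries
`0 ^ p` vanish. -/
lemma norm_polarPow_eq {N : MatrixFunctionFamily} (hN : IsCompatibleNormFamily N)
    (hU : IsUnitaryInvariant N) {m n l : ℕ} (hl : n ≤ l) (A : Matrix (Fin m) (Fin n) ℂ) {p : ℝ}
    (hp : 0 < p) :
    N n n (polarPow A p) = N l l (Matrix.diagonal fun i : Fin l => ((sv A i ^ p : ℝ) : ℂ)) := by
  obtain ⟨U, hUm, h⟩ := exists_unitary_polarPow A hp
  have hV : Uᴴᵀ ∈ Matrix.unitaryGroup (Fin n) ℂ := by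
    have h1 : U * Uᴴ = 1 := Matrix.mem_unitaryGroup_iff.mp hUm
    rw [Matrix.mem_unitaryGroup_iff, Matrix.star_eq_conjTranspose]
    have : Uᴴᵀ * Uᴴᵀᴴ = (U * Uᴴ).map star := by
      ext i j
      simp [Matrix.mul_apply, mul_comm]
    rw [this, h1]
    simp
  have h2 := hU n n (Matrix.diagonal (fun i : Fin n => ((sv A i ^ p : ℝ) : ℂ))) U Uᴴᵀ hUm hV
  rw [Matrix.transpose_transpose, ← h] at h2
  rw [h2, ← hN.blockIncl_eq n n l l _ hl hl]
  congr 1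
  ext i j
  by_cases hij : i = j
  · subst hij
    by_cases hi : (i : ℕ) < n
    · simp [blockIncl, hi]
    · have : sv A i = 0 := sv_eq_zero_of_le A ((min_le_right m n).trans (not_lt.mp hi))
      simp [blockIncl, hi, this, Real.zero_rpow hp.ne']
  · have : (i : ℕ) ≠ j := fun h => hij (Fin.ext h)
    simp [blockIncl, Matrix.diagonal_apply, hij, this]

lemma schattenNorm_eq {m n l : ℕ} (hl : n ≤ l) (A : Matrix (Fin m) (Fin n) ℂ) {p : ℝ}
    (hp : 0 < p) :
    schattenNorm p A = (∑ i : Fin l, |sv A i ^ p|) ^ (1 / p) := by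
  rw [schattenNorm, ← Finset.sum_range fun i => |sv A i ^ p|]
  congr 1
  have h : Finset.range (min m n) ⊆ Finset.range l :=
    Finset.range_mono ((min_le_right m n).trans hl)
  rw [← Finset.sum_subset h (f := fun i => |sv A i ^ p|)]
  · exact Finset.sum_congr rfl fun i _ =>
      (abs_of_nonneg (Real.rpow_nonneg (sv_nonneg A i) p)).symm
  · intro i _ hi
    rw [sv_eq_zero_of_le A (not_lt.mp fun h => hi (Finset.mem_range.mpr h)),
      Real.zero_rpow hp.ne', abs_zero]

/-! ### Assembly -/

/-- The generalised Hölder inequality for a symmetric gauge of the singular values. -/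
lemma IsSymmetricGauge.holder_chainProd {n : ℕ} {Φ : (Fin n → ℝ) → ℝ} (hΦ : IsSymmetricGauge Φ)
    (L : ℕ) (d : Fin (L + 1) → ℕ)
    (A : (i : Fin L) → Matrix (Fin (d i.succ)) (Fin (d i.castSucc)) ℂ)
    (p : Fin L → ℝ) (r : ℝ) (hp : ∀ i, 0 < p i) (hr : 0 < r) (hsum : ∑ i, 1 / p i = 1 / r) :
    Φ (fun i => sv (chainProd L d A) i ^ r) ^ (1 / r)
      ≤ ∏ j, Φ (fun i => sv (A j) i ^ p j) ^ (1 / p j) := by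
  have h1 : Φ (fun i => sv (chainProd L d A) i ^ r) ≤ Φ (fun i => ∏ j, sv (A j) i ^ r) := by
    refine hΦ.le_of_prod_le (x := fun i => sv (chainProd L d A) i ^ r)
      (y := fun i => ∏ j, sv (A j) i ^ r)
      (fun i j hij => Real.rpow_le_rpow (sv_nonneg _ _) (sv_antitone _ hij) hr.le)
      (fun i => Real.rpow_nonneg (sv_nonneg _ _) _)
      (fun i => Finset.prod_nonneg fun j _ => Real.rpow_nonneg (sv_nonneg _ _) _) fun k => ?_
    have e (i : ℕ) : ∏ j, sv (A j) i ^ r = (∏ j, sv (A j) i) ^ r :=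
      Real.finsetProd_rpow _ _ (fun j _ => sv_nonneg _ _) r
    simp only [e]
    rw [Real.finsetProd_rpow _ _ (fun j _ => sv_nonneg _ _) r,
      Real.finsetProd_rpow _ _ (fun i _ => Finset.prod_nonneg fun j _ => sv_nonneg _ _) r]
    exact Real.rpow_le_rpow (Finset.prod_nonneg fun _ _ => sv_nonneg _ _)
      (prod_sv_chainProd_le L d A k) hr.le
  -- The exponents `p j / r` are conjugate: their reciprocals `r / p j` sum to 1.
  have h2 := hΦ.holder (fun j i => sv (A j) i ^ r) (fun j i => Real.rpow_nonneg (sv_nonneg _ _) _)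
    (fun j => p j / r) (fun j => div_pos (hp j) hr) (by
      simp only [one_div_div, div_eq_mul_one_div r]
      rw [← Finset.mul_sum, hsum, mul_one_div_cancel hr.ne'])
  have h3 := Real.rpow_le_rpow (hΦ.nonneg _) (h1.trans h2) (one_div_pos.mpr hr).le
  refine h3.trans_eq ?_
  rw [← Real.finsetProd_rpow _ _ (fun j _ => Real.rpow_nonneg (hΦ.nonneg _) _)]
  refine Finset.prod_congr rfl fun j _ => ?_
  have e1 : (fun i : Fin n => (sv (A j) i ^ r) ^ (p j / r)) =
      fun i : Fin n => sv (A j) i ^ p j := by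
    funext i
    rw [← Real.rpow_mul (sv_nonneg _ _), mul_div_cancel₀ _ hr.ne']
  rw [e1, ← Real.rpow_mul (hΦ.nonneg _)]
  congr 1
  have := (hp j).ne'
  field_simp

end MatrixHolder

theorem mainTheorem2 (L : ℕ) (d : Fin (L + 1) → ℕ)
    (A : (i : Fin L) → Matrix (Fin (d i.succ)) (Fin (d i.castSucc)) ℂ)
    (B : Matrix (Fin (d (Fin.last L))) (Fin (d 0)) ℂ)
    (hB : MatrixHolder.chainProd L d A = B)
    (p : Fin L → ℝ) (r : ℝ) (hp : ∀ i, 0 < p i) (hr : 0 < r)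
    (hsum : ∑ i, 1 / p i = 1 / r) :
    (∀ N : MatrixHolder.MatrixFunctionFamily,
      MatrixHolder.IsCompatibleNormFamily N → MatrixHolder.IsUnitaryInvariant N →
        N (d 0) (d 0) (MatrixHolder.polarPow B r) ^ (1 / r) ≤
          ∏ i, N (d i.castSucc) (d i.castSucc) (MatrixHolder.polarPow (A i) (p i)) ^ (1 / p i)) ∧
    MatrixHolder.schattenNorm r B ≤ ∏ i, MatrixHolder.schattenNorm (p i) (A i) := by
  subst hB
  -- The sum of all dimensions is a convenient common size.
  have hd (i : Fin (L + 1)) : d i ≤ ∑ j, d j :=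
    Finset.single_le_sum (fun _ _ => Nat.zero_le _) (Finset.mem_univ i)
  refine ⟨fun N hN hU => ?_, ?_⟩
  · have h := (MatrixHolder.isSymmetricGauge_diagonal hN hU (∑ j, d j)).holder_chainProd
      L d A p r hp hr hsum
    rw [MatrixHolder.norm_polarPow_eq hN hU (hd 0) _ hr]
    refine h.trans_eq (Finset.prod_congr rfl fun j _ => ?_)
    rw [MatrixHolder.norm_polarPow_eq hN hU (hd j.castSucc) _ (hp j)]
  · have h := (MatrixHolder.isSymmetricGauge_sum_abs (∑ j, d j)).holder_chainProd
      L d A p r hp hr hsum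
    rw [MatrixHolder.schattenNorm_eq (hd 0) _ hr]
    refine h.trans_eq (Finset.prod_congr rfl fun j _ => ?_)
    rw [MatrixHolder.schattenNorm_eq (hd j.castSucc) _ (hp j)]
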